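/- For a prime power $q$ and integers $n,k\ge 0$ let $\left[{n\atop k}\right]_q=\prod_{i=0}^{k-1}\frac{q^{n-i}-1}{q^{k-i}-1}$ denote the Gaussian binomial coefficient. Let $\mathcal A$ be a set of $d+1$ distinct $k$-dimensional subspaces of $\mathbb F_q^n$. Call $\mathcal A$ a $d$-simplex if $\dim\bigl(\bigcap_{A\in\mathcal A}A\bigr)=0$ while the intersection of any $d$ distinct members of $\mathcal A$ has positive dimension; a $d$-cluster if $\dim\bigl(\bigcap_{A\in\mathcal A}A\bigr)=0$ and $\dim\operatorname{span}\bigl(\bigcup_{A\in\mathcal A}A\bigr)\le 2k$; and a $d$-simplex-cluster if it is both a $d$-simplex and a $d$-cluster. **Theorem 4.3.** Let $k\ge d+1\ge 3$. There is an $n_0=n_0(k,d)$ such that for every prime power $q$, every $n\ge n_0$, and every family $\mathcal V$ of $k$-dimensional subspaces of $\mathbb F_q^n$ containing no $d$-simplex-cluster, $$|\mathcal V|<q^{\,n-k}\left[{n-1\atop k-1}\right]_q=\left[{n\atop k}\right]_q-\left[{n-1\atop k}\right]_q .$$ -/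

import Mathlib

/-- The Gaussian (or `q`-binomial) coefficient
`[n, k]_q = ∏_{0 ≤ i ≤ k - 1} (q ^ (n - i) - 1) / (q ^ (k - i) - 1)`, as a rational number.
If `n < k`, the factor with `i = n` vanishes, so that the value is `0` as usual. -/
def gaussBinom (q n k : ℕ) : ℚ :=
  ∏ i ∈ Finset.range k, ((q : ℚ) ^ (n - i) - 1) / ((q : ℚ) ^ (k - i) - 1)

/-- A set `A` of `d + 1` (distinct) `k`-dimensional subspaces is a `d`-simplex if all its members
intersect trivially, while any `d` of them have an intersection of positive dimension. -/
def IsSubspaceSimplex {F E : Type*} [Field F] [AddCommGroup E] [Module F E]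
    (d k : ℕ) (A : Finset (Submodule F E)) : Prop :=
  A.card = d + 1 ∧ (∀ W ∈ A, Module.finrank F W = k) ∧
    Module.finrank F (⨅ W ∈ A, W : Submodule F E) = 0 ∧
    ∀ B ⊆ A, B.card = d → 0 < Module.finrank F (⨅ W ∈ B, W : Submodule F E)

/-- A set `A` of `d + 1` (distinct) `k`-dimensional subspaces is a `d`-cluster if all its members
intersect trivially and their union spans a subspace of dimension at most `2 * k`. -/
def IsSubspaceCluster {F E : Type*} [Field F] [AddCommGroup E] [Module F E]
    (d k : ℕ) (A : Finset (Submodule F E)) : Prop :=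
  A.card = d + 1 ∧ (∀ W ∈ A, Module.finrank F W = k) ∧
    Module.finrank F (⨅ W ∈ A, W : Submodule F E) = 0 ∧
    Module.finrank F (Submodule.span F (⋃ W ∈ A, (W : Set E))) ≤ 2 * k

/-- A `d`-simplex-cluster is both a `d`-simplex and a `d`-cluster. -/
def IsSubspaceSimplexCluster {F E : Type*} [Field F] [AddCommGroup E] [Module F E]
    (d k : ℕ) (A : Finset (Submodule F E)) : Prop :=
  IsSubspaceSimplex d k A ∧ IsSubspaceCluster d k A

/-! The complement of a large family is sparse, so a union bound suffices. Among all `k`-dimensional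
subspaces of `F ^ n`, the proportion `[n - 1, k]_q / [n, k]_q = (q ^ (n - k) - 1) / (q ^ n - 1)` is
less than `q ^ (-k)`. Hence a family `𝒱` with at least `[n, k]_q - [n - 1, k]_q` members misses less
than a proportion `q ^ (-k)` of them, and `(d + 1) * q ^ (-k) < 1` because `d + 1 ≤ k`.

For `n ≥ 2 * k` there is a `d`-simplex-cluster `S 0, …, S d` of coordinate subspaces
(`exists_coordinate_sets`, `isSubspaceSimplexCluster_of_basis`). Its image under a uniformly random
linear automorphism `g` is again a `d`-simplex-cluster, and each `g (S i)` is uniformly distributed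
over the `k`-dimensional subspaces (`card_filter_map_mem_mul`). So with positive probability all
`g (S i)` lie in `𝒱` (`exists_linearEquiv_forall_map_mem`). The number of `k`-dimensional subspaces
is identified with the Gaussian binomial coefficient by counting linearly independent `k`-tuples
according to their span (`card_finrank_eq_gaussBinom`). -/

/-! ### Identities for Gaussian binomial coefficients -/

section GaussBinom

/-- The absorption identity `[n + 1, k + 1]_q (q ^ (k + 1) - 1) = (q ^ (n + 1) - 1) [n, k]_q`. -/
theorem gaussBinom_succ_succ_mul {q : ℕ} (hq : 1 < q) (n k : ℕ) :
    gaussBinom q (n + 1) (k + 1) * ((q : ℚ) ^ (k + 1) - 1) =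
      ((q : ℚ) ^ (n + 1) - 1) * gaussBinom q n k := by
  have h : (q : ℚ) ^ (k + 1) - 1 ≠ 0 := by
    have : (1 : ℚ) < (q : ℚ) ^ (k + 1) := one_lt_pow₀ (by exact_mod_cast hq) (by omega)
    linarith
  unfold gaussBinom
  rw [Finset.prod_range_succ']
  simp only [Nat.add_sub_add_right, Nat.sub_zero]
  field_simp

theorem gaussBinom_succ_mul (q n k : ℕ) :
    ((q : ℚ) ^ (n + 1) - 1) * gaussBinom q n k =
      ((q : ℚ) ^ (n + 1 - k) - 1) * gaussBinom q (n + 1) k := by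
  unfold gaussBinom
  rw [Finset.prod_div_distrib, Finset.prod_div_distrib, mul_div_assoc', mul_div_assoc']
  congr 1
  have h := (Finset.prod_range_succ (fun i => (q : ℚ) ^ (n + 1 - i) - 1) k).symm.trans
    (Finset.prod_range_succ' _ k)
  simp only [Nat.add_sub_add_right, Nat.sub_zero] at h
  linarith

theorem gaussBinom_pos {q : ℕ} (hq : 1 < q) {n k : ℕ} (hk : k ≤ n) : 0 < gaussBinom q n k := by
  refine Finset.prod_pos fun i hi => ?_
  have hi := Finset.mem_range.1 hi
  have h (m : ℕ) (hm : m ≠ 0) : (0 : ℚ) < (q : ℚ) ^ m - 1 :=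
    sub_pos.2 (one_lt_pow₀ (by exact_mod_cast hq) hm)
  exact div_pos (h _ (by omega)) (h _ (by omega))

theorem pow_mul_gaussBinom_eq_sub {q : ℕ} (hq : 1 < q) (n k : ℕ) (hk : k + 1 ≤ n) :
    (q : ℚ) ^ (n + 1 - (k + 1)) * gaussBinom q n k =
      gaussBinom q (n + 1) (k + 1) - gaussBinom q n (k + 1) := by
  have h1 := gaussBinom_succ_succ_mul hq n k
  have h2 := gaussBinom_succ_mul q n (k + 1)
  have hpos (m : ℕ) : (0 : ℚ) < (q : ℚ) ^ (m + 1) - 1 :=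
    sub_pos.2 (one_lt_pow₀ (by exact_mod_cast hq) (by omega))
  have h3 : (q : ℚ) ^ (n + 1) = (q : ℚ) ^ (n + 1 - (k + 1)) * (q : ℚ) ^ (k + 1) := by
    rw [← pow_add]; congr 1; omega
  have hk0 := (hpos k).ne'
  have hn0 := (hpos n).ne'
  apply mul_left_cancel₀ hn0
  rw [mul_sub, h2]
  linear_combination (-(q : ℚ) ^ (n + 1 - (k + 1))) * h1 - gaussBinom q (n + 1) (k + 1) * h3

theorem mul_gaussBinom_lt {q : ℕ} (hq : 1 < q) {n k d : ℕ} (hk : k ≤ n) (hd₀ : 0 < d) (hd : d < k) :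
    ((d : ℚ) + 1) * gaussBinom q n k < gaussBinom q (n + 1) k := by
  have hq1 : (1 : ℚ) < q := by exact_mod_cast hq
  have hn : (0 : ℚ) < (q : ℚ) ^ (n + 1) - 1 := sub_pos.2 (one_lt_pow₀ hq1 (by omega))
  have h2 := gaussBinom_succ_mul q n k
  have hpow : (d : ℚ) + 1 ≤ (q : ℚ) ^ k := by
    have : d + 1 ≤ q ^ k := (Nat.succ_le_of_lt hd).trans (Nat.lt_pow_self hq).le
    exact_mod_cast this
  have hd' : (0 : ℚ) < d := by exact_mod_cast hd₀
  have h3 : (q : ℚ) ^ (n + 1) = (q : ℚ) ^ (n + 1 - k) * (q : ℚ) ^ k := by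
    rw [← pow_add]; congr 1; omega
  have h4 : ((d : ℚ) + 1) * ((q : ℚ) ^ (n + 1 - k) - 1) < (q : ℚ) ^ (n + 1) - 1 := by
    have : ((d : ℚ) + 1) * (q : ℚ) ^ (n + 1 - k) ≤ (q : ℚ) ^ (n + 1) := by
      rw [h3, mul_comm]
      exact mul_le_mul_of_nonneg_left hpow (by positivity)
    linarith
  refine lt_of_mul_lt_mul_left ?_ hn.le
  calc _ = (((d : ℚ) + 1) * ((q : ℚ) ^ (n + 1 - k) - 1)) * gaussBinom q (n + 1) k := by
        linear_combination ((d : ℚ) + 1) * h2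
    _ < _ := mul_lt_mul_of_pos_right h4 (gaussBinom_pos hq (by omega))

end GaussBinom

/-! ### The number of `k`-dimensional subspaces -/

section Counting

variable {F E : Type*} [Field F] [AddCommGroup E] [Module F E]

/-- Linearly independent `k`-tuples spanning a given `k`-dimensional subspace `W` are the same as
linearly independent `k`-tuples of vectors of `W`. -/
noncomputable def linearIndependentSpanEquiv [FiniteDimensional F E] {k : ℕ} (W : Submodule F E)
    (hW : Module.finrank F W = k) :
    {s : {s : Fin k → E // LinearIndependent F s} // Submodule.span F (Set.range s.1) = W} ≃
      {s : Fin k → W // LinearIndependent F s} where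
  toFun s := ⟨fun i => ⟨s.1.1 i, s.2.le (Submodule.subset_span ⟨i, rfl⟩)⟩,
    LinearIndependent.of_comp W.subtype s.1.2⟩
  invFun s := ⟨⟨fun i => s.1 i, s.2.map' W.subtype W.ker_subtype⟩, by
    have hs : LinearIndependent F fun i => (s.1 i : E) := s.2.map' W.subtype W.ker_subtype
    refine Submodule.eq_of_le_of_finrank_eq (Submodule.span_le.2 ?_) ?_
    · rintro _ ⟨i, rfl⟩
      exact (s.1 i).2
    · rw [finrank_span_eq_card hs, hW, Fintype.card_fin]⟩
  left_inv _ := rfl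
  right_inv _ := rfl

open Classical in
theorem card_finrank_eq_mul [Fintype F] [Finite E] [Fintype (Submodule F E)] {k : ℕ}
    (hk : k ≤ Module.finrank F E) :
    (Finset.univ.filter fun W : Submodule F E => Module.finrank F W = k).card *
      ∏ i : Fin k, (Fintype.card F ^ k - Fintype.card F ^ i.val) =
      ∏ i : Fin k, (Fintype.card F ^ Module.finrank F E - Fintype.card F ^ i.val) := by
  have := Fintype.ofFinite {s : Fin k → E // LinearIndependent F s}
  rw [← card_linearIndependent hk, Nat.card_eq_fintype_card,
    ← Finset.card_univ (α := {s : Fin k → E // LinearIndependent F s}),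
    Finset.card_eq_sum_card_fiberwise
      (f := fun s : {s : Fin k → E // LinearIndependent F s} => Submodule.span F (Set.range s.1))
      (t := Finset.univ.filter fun W : Submodule F E => Module.finrank F W = k)
      (fun s _ => by simp [finrank_span_eq_card s.2]),
    Finset.sum_const_nat]
  intro W hW
  have hW : Module.finrank F W = k := by simpa using hW
  rw [← Fintype.card_subtype, ← Nat.card_eq_fintype_card,
    Nat.card_congr (linearIndependentSpanEquiv W hW), card_linearIndependent hW.ge, hW]

open Classical in
theorem card_finrank_eq_gaussBinom [Fintype F] [Finite E] [Fintype (Submodule F E)] {k : ℕ}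
    (hk : k ≤ Module.finrank F E) :
    ((Finset.univ.filter fun W : Submodule F E => Module.finrank F W = k).card : ℚ) =
      gaussBinom (Fintype.card F) (Module.finrank F E) k := by
  have hq : 1 < Fintype.card F := Fintype.one_lt_card
  set q := Fintype.card F
  have hq1 : (1 : ℚ) < q := by exact_mod_cast hq
  have hprod (m : ℕ) (hm : k ≤ m) : ((∏ i : Fin k, (q ^ m - q ^ i.val) : ℕ) : ℚ) =
      (∏ i ∈ Finset.range k, (q : ℚ) ^ i) * ∏ i ∈ Finset.range k, ((q : ℚ) ^ (m - i) - 1) := by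
    rw [Fin.prod_univ_eq_prod_range (fun i => q ^ m - q ^ i), ← Finset.prod_mul_distrib,
      Nat.cast_prod]
    refine Finset.prod_congr rfl fun i hi => ?_
    have hi : i ≤ m := (Finset.mem_range.1 hi).le.trans hm
    rw [Nat.cast_sub (Nat.pow_le_pow_right hq.le hi), mul_sub, ← pow_add,
      Nat.add_sub_cancel' hi, mul_one]
    push_cast
    rfl
  have h := congrArg (Nat.cast : ℕ → ℚ) (card_finrank_eq_mul (F := F) (E := E) hk)
  rw [Nat.cast_mul, hprod k le_rfl, hprod _ hk] at h
  have h0 : (∏ i ∈ Finset.range k, (q : ℚ) ^ i) ≠ 0 :=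
    Finset.prod_ne_zero_iff.2 fun i _ => by positivity
  have h1 : (∏ i ∈ Finset.range k, ((q : ℚ) ^ (k - i) - 1)) ≠ 0 :=
    Finset.prod_ne_zero_iff.2 fun i hi =>
      (sub_pos.2 (one_lt_pow₀ hq1 (Nat.sub_ne_zero_of_lt (Finset.mem_range.1 hi)))).ne'
  rw [gaussBinom, Finset.prod_div_distrib, eq_div_iff h1]
  exact mul_left_cancel₀ h0 (by linear_combination h)

end Counting

/-! ### Images of subspaces under a random automorphism -/

section RandomImage

variable {F E : Type*} [Field F] [AddCommGroup E] [Module F E] [FiniteDimensional F E]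

/-- Linear automorphisms act transitively on the subspaces of a given dimension. -/
theorem exists_linearEquiv_map_eq {W W' : Submodule F E}
    (h : Module.finrank F W = Module.finrank F W') :
    ∃ g : E ≃ₗ[F] E, W.map g.toLinearMap = W' := by
  obtain ⟨g, hg⟩ := Submodule.exists_linearEquiv_restrict_eq (LinearEquiv.ofFinrankEq W W' h)
  refine ⟨g, Submodule.eq_of_le_of_finrank_eq ?_ ?_⟩
  · rintro _ ⟨x, hx, rfl⟩
    have := hg ⟨x, hx⟩
    simp only [LinearEquiv.coe_coe]
    exact this ▸ Subtype.property _
  · rw [← h]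
    exact LinearEquiv.finrank_map_eq g W

variable [Fintype (E ≃ₗ[F] E)]

open Classical in
theorem card_filter_map_eq (S : Submodule F E) {W W' : Submodule F E}
    (h : Module.finrank F W = Module.finrank F W') :
    (Finset.univ.filter fun g : E ≃ₗ[F] E => S.map g.toLinearMap = W).card =
      (Finset.univ.filter fun g : E ≃ₗ[F] E => S.map g.toLinearMap = W').card := by
  obtain ⟨e, rfl⟩ := exists_linearEquiv_map_eq h
  refine Finset.card_bij (fun g _ => g.trans e) ?_ ?_ ?_
  · intro g hg
    simp only [Finset.mem_filter, Finset.mem_univ, true_and] at hg ⊢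
    rw [LinearEquiv.coe_trans, Submodule.map_comp, hg]
  · intro g _ g' _ hgg
    ext x
    exact e.injective (LinearEquiv.congr_fun hgg x)
  · intro g hg
    simp only [Finset.mem_filter, Finset.mem_univ, true_and] at hg
    refine ⟨g.trans e.symm, ?_, by ext; simp⟩
    simp only [Finset.mem_filter, Finset.mem_univ, true_and]
    rw [LinearEquiv.coe_trans, Submodule.map_comp, hg, ← Submodule.map_comp]
    simp

variable [Fintype (Submodule F E)]

open Classical in
/-- The image of a `k`-dimensional subspace under a uniformly random linear automorphism is
uniformly distributed over all `k`-dimensional subspaces. -/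
theorem card_filter_map_mem_mul {k : ℕ} (S : Submodule F E) (hS : Module.finrank F S = k)
    (Y : Finset (Submodule F E)) (hY : ∀ W ∈ Y, Module.finrank F W = k) :
    (Finset.univ.filter fun g : E ≃ₗ[F] E => S.map g.toLinearMap ∈ Y).card *
      (Finset.univ.filter fun W : Submodule F E => Module.finrank F W = k).card =
      Y.card * Fintype.card (E ≃ₗ[F] E) := by
  have key (Z : Finset (Submodule F E)) (hZ : ∀ W ∈ Z, Module.finrank F W = k) :
      (Finset.univ.filter fun g : E ≃ₗ[F] E => S.map g.toLinearMap ∈ Z).card =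
        Z.card * (Finset.univ.filter fun g : E ≃ₗ[F] E => S.map g.toLinearMap = S).card := by
    rw [Finset.card_eq_sum_card_fiberwise (f := fun g : E ≃ₗ[F] E => S.map g.toLinearMap) (t := Z)
      (fun g hg => by simpa using hg)]
    refine Finset.sum_const_nat fun W hW => ?_
    rw [Finset.filter_filter, ← card_filter_map_eq S ((hZ W hW).trans hS.symm)]
    congr 1
    ext g
    simp only [Finset.mem_filter, Finset.mem_univ, true_and, and_iff_right_iff_imp]
    rintro rfl
    exact hW
  have hall := key (Finset.univ.filter fun W : Submodule F E => Module.finrank F W = k)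
    (fun W hW => by simpa using hW)
  have huniv : (Finset.univ.filter fun g : E ≃ₗ[F] E => S.map g.toLinearMap ∈
      Finset.univ.filter fun W : Submodule F E => Module.finrank F W = k) = Finset.univ := by
    refine Finset.filter_true_of_mem fun g _ => ?_
    simp only [Finset.mem_filter, Finset.mem_univ, true_and]
    exact (LinearEquiv.finrank_map_eq g S).trans hS
  rw [huniv, Finset.card_univ] at hall
  rw [key Y hY, hall]
  ring

open Classical in
/-- The union bound: if the family `𝒱` misses less than a proportion `1 / m` of the
`k`-dimensional subspaces, then some automorphism maps `m` given ones into `𝒱`. -/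
theorem exists_linearEquiv_forall_map_mem {k m : ℕ} (S : Fin m → Submodule F E)
    (hS : ∀ i, Module.finrank F (S i) = k) (𝒱 : Finset (Submodule F E))
    (h : m * ((Finset.univ.filter fun W : Submodule F E => Module.finrank F W = k) \ 𝒱).card <
      (Finset.univ.filter fun W : Submodule F E => Module.finrank F W = k).card) :
    ∃ g : E ≃ₗ[F] E, ∀ i, (S i).map g.toLinearMap ∈ 𝒱 := by
  by_contra! hcon
  set X := Finset.univ.filter fun W : Submodule F E => Module.finrank F W = k
  have hcover : (Finset.univ : Finset (E ≃ₗ[F] E)) ⊆ Finset.univ.biUnion fun i : Fin m =>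
      Finset.univ.filter fun g : E ≃ₗ[F] E => (S i).map g.toLinearMap ∈ X \ 𝒱 := by
    intro g _
    obtain ⟨i, hi⟩ := hcon g
    simp only [Finset.mem_biUnion, Finset.mem_univ, true_and, Finset.mem_filter,
      Finset.mem_sdiff, X]
    exact ⟨i, (LinearEquiv.finrank_map_eq g (S i)).trans (hS i), hi⟩
  have hle := (Finset.card_le_card hcover).trans Finset.card_biUnion_le
  have hmul := Nat.mul_le_mul_right X.card hle
  rw [Finset.sum_mul, Finset.sum_congr rfl fun i _ => card_filter_map_mem_mul (S i) (hS i) (X \ 𝒱)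
    (fun W hW => by simpa [X] using (Finset.mem_sdiff.1 hW).1)] at hmul
  simp only [Finset.card_univ, Finset.sum_const, smul_eq_mul, Fintype.card_fin] at hmul
  have hpos : 0 < Fintype.card (E ≃ₗ[F] E) := Fintype.card_pos
  nlinarith

end RandomImage

/-! ### Coordinate subspaces forming a simplex-cluster -/

section Cluster

/-- Index sets of the coordinate subspaces of a `d`-simplex-cluster: `d`-element subsets of
`{0, …, d}`, each padded with one of two disjoint blocks of `k - d` further indices. Two different
blocks occur, so that no index beyond `d` is common to all sets. -/
theorem exists_coordinate_sets {k d n : ℕ} (hd : 1 ≤ d) (hk : d < k) (hn : 2 * k ≤ n) :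
    ∃ (T : Fin (d + 1) → Finset (Fin n)) (e : Fin (d + 1) → Fin n) (U : Finset (Fin n)),
      (∀ i, (T i).card = k) ∧ (∀ i j, e j ∈ T i ↔ i ≠ j) ∧ (∀ x, ∃ i, x ∉ T i) ∧
        (∀ i, T i ⊆ U) ∧ U.card ≤ 2 * k := by
  let T' (i : ℕ) : Finset ℕ :=
    (Finset.range (d + 1)).erase i ∪ if i = 0 then Finset.Ioc d k else Finset.Ioc k (2 * k - d)
  have hlt (i : ℕ) : ∀ x ∈ T' i, x < 2 * k := by
    intro x hx
    simp only [T', Finset.mem_union, Finset.mem_erase, Finset.mem_range] at hx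
    split_ifs at hx <;> simp only [Finset.mem_Ioc] at hx <;> omega
  have hcard (i : ℕ) (hi : i < d + 1) : (T' i).card = k := by
    rw [Finset.card_union_of_disjoint, Finset.card_erase_of_mem (Finset.mem_range.2 hi)]
    · split_ifs <;> simp only [Finset.card_range, Nat.card_Ioc] <;> omega
    · rw [Finset.disjoint_left]
      intro x hx
      simp only [Finset.mem_erase, Finset.mem_range] at hx
      split_ifs <;> simp only [Finset.mem_Ioc] <;> omega
  refine ⟨fun i => (T' i).attachFin fun x hx => (hlt i x hx).trans_le hn,
    fun j => ⟨j, by omega⟩, (Finset.range (2 * k)).attachFin fun x hx =>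
      (Finset.mem_range.1 hx).trans_le hn, ?_, ?_, ?_, ?_, ?_⟩
  · intro i
    rw [Finset.card_attachFin, hcard i i.2]
  · intro i j
    simp only [Finset.mem_attachFin, T', Finset.mem_union, Finset.mem_erase, Finset.mem_range,
      ne_eq, Fin.ext_iff]
    split_ifs <;> simp only [Finset.mem_Ioc] <;> omega
  · intro x
    simp only [Finset.mem_attachFin]
    by_cases hx : (x : ℕ) ≤ d
    · refine ⟨⟨x, by omega⟩, ?_⟩
      simp only [T', Finset.mem_union, Finset.mem_erase, Finset.mem_range]
      split_ifs <;> simp only [Finset.mem_Ioc] <;> omega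
    · by_cases hxk : (x : ℕ) ≤ k
      · refine ⟨⟨1, by omega⟩, ?_⟩
        simp only [T', Finset.mem_union, Finset.mem_erase, Finset.mem_range, one_ne_zero,
          if_false, Finset.mem_Ioc]
        omega
      · refine ⟨⟨0, by omega⟩, ?_⟩
        simp only [T', Finset.mem_union, Finset.mem_erase, Finset.mem_range, if_true,
          Finset.mem_Ioc]
        omega
  · intro i x hx
    rw [Finset.mem_attachFin] at hx ⊢
    exact Finset.mem_range.2 (hlt i x hx)
  · rw [Finset.card_attachFin, Finset.card_range]

/-- Coordinate subspaces with respect to any basis form a `d`-simplex-cluster, if the index sets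
have the corresponding properties. -/
theorem isSubspaceSimplexCluster_of_basis {F E ι : Type*} [Field F] [AddCommGroup E] [Module F E]
    [Fintype ι] [DecidableEq (Submodule F E)] (b : Module.Basis ι F E) {k d : ℕ}
    (T : Fin (d + 1) → Finset ι) (e : Fin (d + 1) → ι) (U : Finset ι)
    (hT : ∀ i, (T i).card = k) (he : ∀ i j, e j ∈ T i ↔ i ≠ j) (hinter : ∀ x, ∃ i, x ∉ T i)
    (hU : ∀ i, T i ⊆ U) (hUcard : U.card ≤ 2 * k) :
    IsSubspaceSimplexCluster d k
      (Finset.univ.image fun i => Submodule.span F (b '' (T i : Set ι))) := by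
  have := b.finiteDimensional_of_finite
  have hdim (s : Finset ι) : Module.finrank F (Submodule.span F (b '' (s : Set ι))) = s.card := by
    classical
    rw [← Finset.coe_image, finrank_span_finset_eq_card,
      Finset.card_image_of_injective _ b.injective]
    rw [Finset.coe_image]
    exact b.linearIndependent.linearIndepOn_id.mono (Set.image_subset_range _ _)
  have hmem (i j) : b (e j) ∈ Submodule.span F (b '' (T i : Set ι)) ↔ i ≠ j := by
    rw [b.self_mem_span_image, Finset.mem_coe, he]
  have hinj : Function.Injective fun i => Submodule.span F (b '' (T i : Set ι)) := by
    intro i j hij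
    by_contra hne
    have h := (hmem i j).2 hne
    simp only at hij
    rw [hij, hmem] at h
    exact h rfl
  have hcard : (Finset.univ.image fun i => Submodule.span F (b '' (T i : Set ι))).card = d + 1 := by
    rw [Finset.card_image_of_injective _ hinj, Finset.card_univ, Fintype.card_fin]
  have hfin : ∀ W ∈ Finset.univ.image fun i => Submodule.span F (b '' (T i : Set ι)),
      Module.finrank F W = k := by
    intro W hW
    obtain ⟨i, -, rfl⟩ := Finset.mem_image.1 hW
    rw [hdim, hT]
  have hzero : Module.finrank F (⨅ W ∈ Finset.univ.image
      fun i => Submodule.span F (b '' (T i : Set ι)), W : Submodule F E) = 0 := by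
    rw [Submodule.finrank_eq_zero, eq_bot_iff]
    intro x hx
    simp only [Submodule.mem_iInf, Finset.mem_image, Finset.mem_univ, true_and,
      forall_exists_index, forall_apply_eq_imp_iff, b.mem_span_image] at hx
    rw [Submodule.mem_bot, ← b.repr.map_eq_zero_iff]
    ext j
    obtain ⟨i, hi⟩ := hinter j
    by_contra hj
    exact hi (hx i (by simpa using hj))
  refine ⟨⟨hcard, hfin, hzero, ?_⟩, hcard, hfin, hzero, ?_⟩
  · intro B hB hBcard
    obtain ⟨W, hW, hWB⟩ := Finset.exists_of_ssubset (hB.ssubset_of_ne (by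
      rintro rfl
      omega))
    obtain ⟨j, -, rfl⟩ := Finset.mem_image.1 hW
    refine Module.finrank_pos_iff_exists_ne_zero.2 ⟨⟨b (e j), ?_⟩, fun h => b.ne_zero (e j) ?_⟩
    · simp only [Submodule.mem_iInf]
      intro W' hW'
      obtain ⟨i, -, rfl⟩ := Finset.mem_image.1 (hB hW')
      refine (hmem i j).2 ?_
      rintro rfl
      exact hWB hW'
    · exact congrArg Subtype.val h
  · refine (Submodule.finrank_mono (Submodule.span_le.2 (Set.iUnion₂_subset fun W hW => ?_))).trans
      ((hdim U).trans_le hUcard)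
    obtain ⟨i, -, rfl⟩ := Finset.mem_image.1 hW
    exact Submodule.span_mono (Set.image_mono (hU i))

end Cluster

theorem theorem4p3 (k d : ℕ) (hd : 3 ≤ d + 1) (hk : d + 1 ≤ k) :
    ∃ n₀ : ℕ, ∀ (F : Type*) [Field F] [Fintype F] (q : ℕ), Fintype.card F = q →
      ∀ n : ℕ, n₀ ≤ n →
        ∀ 𝒱 : Finset (Submodule F (Fin n → F)),
          (∀ W ∈ 𝒱, Module.finrank F W = k) →
          (∀ A ⊆ 𝒱, ¬ IsSubspaceSimplexCluster d k A) →
          (𝒱.card : ℚ) < (q : ℚ) ^ (n - k) * gaussBinom q (n - 1) (k - 1) ∧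
            (q : ℚ) ^ (n - k) * gaussBinom q (n - 1) (k - 1) =
              gaussBinom q n k - gaussBinom q (n - 1) k := by
  classical
  refine ⟨2 * k, ?_⟩
  rintro F _ _ q rfl n hn 𝒱 h𝒱 hfree
  have hq : 1 < Fintype.card F := Fintype.one_lt_card
  have hpascal := pow_mul_gaussBinom_eq_sub hq (n - 1) (k - 1) (by omega)
  rw [Nat.sub_add_cancel (by omega), Nat.sub_add_cancel (by omega)] at hpascal
  refine ⟨?_, hpascal⟩
  rw [hpascal]
  by_contra! hlarge
  have := Fintype.ofFinite (Submodule F (Fin n → F))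
  have : Finite ((Fin n → F) ≃ₗ[F] (Fin n → F)) := DFunLike.finite _
  have := Fintype.ofFinite ((Fin n → F) ≃ₗ[F] (Fin n → F))
  have hX := card_finrank_eq_gaussBinom (F := F) (E := Fin n → F) (k := k)
    (by rw [Module.finrank_fin_fun]; omega)
  rw [Module.finrank_fin_fun] at hX
  obtain ⟨T, e, U, hT, he, hinter, hU, hUcard⟩ :=
    exists_coordinate_sets (k := k) (d := d) (n := n) (by omega) (by omega) hn
  have hdense : (d + 1) * ((Finset.univ.filter
      fun W : Submodule F (Fin n → F) => Module.finrank F W = k) \ 𝒱).card <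
      (Finset.univ.filter fun W : Submodule F (Fin n → F) => Module.finrank F W = k).card := by
    have hsub : 𝒱 ⊆ Finset.univ.filter fun W : Submodule F (Fin n → F) => Module.finrank F W = k :=
      fun W hW => by simpa using h𝒱 W hW
    have hlt := mul_gaussBinom_lt hq (n := n - 1) (k := k) (d := d) (by omega) (by omega) (by omega)
    rw [Nat.sub_add_cancel (by omega)] at hlt
    have hcast := Finset.cast_card_sdiff (R := ℚ) hsub
    rw [← Nat.cast_lt (α := ℚ), Nat.cast_mul, hcast, hX, Nat.cast_succ]
    refine lt_of_le_of_lt (mul_le_mul_of_nonneg_left ?_ (by positivity)) hlt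
    linarith
  let b : Module.Basis (Fin n) F (Fin n → F) := Pi.basisFun F (Fin n)
  have hS (i) : Module.finrank F (Submodule.span F (b '' (T i : Set (Fin n)))) = k :=
    (isSubspaceSimplexCluster_of_basis b T e U hT he hinter hU hUcard).1.2.1 _
      (Finset.mem_image_of_mem _ (Finset.mem_univ i))
  obtain ⟨g, hg⟩ := exists_linearEquiv_forall_map_mem _ hS 𝒱 hdense
  refine hfree _ ?_
    (isSubspaceSimplexCluster_of_basis (b.map g) T e U hT he hinter hU hUcard)
  intro W hW
  obtain ⟨i, -, rfl⟩ := Finset.mem_image.1 hW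
  have := hg i
  rw [Submodule.map_span, ← Set.image_comp] at this
  convert this using 3
  exact b.map_apply g _
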